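/- Let $\Sigma$ be a non-empty finite alphabet. The logic $\mathsf{SeqStr}$ over $\Sigma$ has three sorts: integers, strings (elements of $\Sigma^*$) and sequences (finite sequences of strings), each with countably many variables. Regular expressions are built from $\emptyset$, $\varepsilon$ and the letters of $\Sigma$ by union, concatenation and star. Terms are $$it ::= m \mid \mathfrak m \mid it+it \mid it-it \mid \mathsf{strlen}(strt)\mid \mathsf{seqlen}(seqt),$$ $$strt ::= u \mid \mathfrak u \mid strt\cdot strt \mid \mathsf{nth}(seqt,it)\mid \mathsf{join}_u(seqt),$$ $$seqt ::= (strt)\mid s\mid \mathfrak s\mid seqt\cdot seqt\mid seqt[it\to strt]\mid \mathsf{filter}_e(seqt)\mid seqt[it,it]\mid \mathsf{split}_e(strt)\mid\mathsf{matchAll}_e(strt),$$ where $m,u,s$ are constants and $\mathfrak m,\mathfrak u,\mathfrak s$ variables of the sorts integer, string and sequence, and $e$ is a regular expression. Formulas are $$\varphi ::= it\bowtie it\mid seqt=seqt\mid strt=strt\mid strt\in e\mid\varphi\wedge\varphi,\qquad \bowtie\ \in\{=,\neq,<,\le,>,\ge\}.$$ Semantics, for a sequence $s=(u_0,\dots,u_{m-1})$: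 $\mathsf{strlen}$ and $\mathsf{seqlen}$ are the lengths; $\cdot$ is concatenation; $(u)$ is the sequence with the single element $u$; $\mathsf{nth}(s,i)=u_i$ if $0\le i<m$, and is undefined otherwise; $\mathsf{join}_v(s)=u_0vu_1v\cdots vu_{m-1}$ (the empty string if $m=0$); $s[i\to u]$ is $s$ with $u_i$ replaced by $u$ if $0\le i<m$, and is $s$ otherwise; $\mathsf{filter}_e(s)$ is the subsequence of the elements that belong to $\mathcal L(e)$; $s[i,j]$ is the subsequence of the at most $j$ elements of $s$ from $u_i$ on if $0\le i<m$ and $j\ge 0$, and is undefined otherwise. Further, $\mathsf{split}_e(u)=(u'_1,\dots,u'_k)$ and $\mathsf{matchAll}_e(u)=(v_1,\dots,v_{k-1})$, where $u=u'_1v_1u'_2v_2\cdots u'_{k-1}v_{k-1}u'_k$, each $v_i$ is the leftmost and longest substring of $u'_iv_iu'_{i+1}\cdots v_{k-1}u'_k$ that belongs to $\mathcal L(e)$, and no substring of $u'_k$ belongs to $\mathcal L(e)$; both are undefined if there is no such decomposition. An atomic formula holds only if all its terms are defined. A formula is satisfiable if some assignment of values to the variables makes it true. Then the satisfiability of $\mathsf{SeqStr}$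 formulas is undecidable: there is no algorithm that, given (a Gödel number of) a $\mathsf{SeqStr}$ formula over $\Sigma$, decides whether it is satisfiable. -/

import Mathlib

/-!
The logic of string sequences: integers, strings over a finite alphabet `α`, and finite
sequences of strings. This file has its terms and formulas, their semantics, and a Gödel
numbering of the formulas.
-/

namespace SeqStr

/-- The three data types of the logic: integers, strings, string sequences. -/
inductive Ty
  | int
  | str
  | seq

/-- The values of each data type. -/
abbrev Ty.Val (α : Type) : Ty → Type
  | .int => ℤ
  | .str => List α
  | .seq => List (List α)

/-- Integer, string and sequence terms over the alphabet `α`. The variables of each data type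
are numbered by the natural numbers. -/
inductive Term (α : Type) : Ty → Type
  /-- an integer constant -/
  | intConst (m : ℤ) : Term α .int
  /-- an integer variable -/
  | intVar (n : ℕ) : Term α .int
  | add (t₁ t₂ : Term α .int) : Term α .int
  | sub (t₁ t₂ : Term α .int) : Term α .int
  | strlen (t : Term α .str) : Term α .int
  | seqlen (t : Term α .seq) : Term α .int
  /-- a string constant -/
  | strConst (u : List α) : Term α .str
  /-- a string variable -/
  | strVar (n : ℕ) : Term α .str
  /-- concatenation of strings -/
  | strCat (t₁ t₂ : Term α .str) : Term α .str
  /-- the element of a sequence at a given position -/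
  | nth (s : Term α .seq) (i : Term α .int) : Term α .str
  /-- `join_u(s)`, where `u` is a string constant -/
  | join (u : List α) (s : Term α .seq) : Term α .str
  /-- the sequence with a single element -/
  | single (t : Term α .str) : Term α .seq
  /-- a sequence constant -/
  | seqConst (s : List (List α)) : Term α .seq
  /-- a sequence variable -/
  | seqVar (n : ℕ) : Term α .seq
  /-- concatenation of sequences -/
  | seqCat (s₁ s₂ : Term α .seq) : Term α .seq
  /-- the sequence write `s[i → t]` -/
  | write (s : Term α .seq) (i : Term α .int) (t : Term α .str) : Term α .seq
  /-- `filter_e(s)` -/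
  | filter (e : RegularExpression α) (s : Term α .seq) : Term α .seq
  /-- the subsequence `s[i, j]` -/
  | subseq (s : Term α .seq) (i j : Term α .int) : Term α .seq
  /-- `split_e(t)` -/
  | split (e : RegularExpression α) (t : Term α .str) : Term α .seq
  /-- `matchAll_e(t)` -/
  | matchAll (e : RegularExpression α) (t : Term α .str) : Term α .seq

/-- The comparisons `=, ≠, <, ≤, >, ≥` of integer terms. -/
inductive Cmp
  | eq
  | ne
  | lt
  | le
  | gt
  | ge

/-- Formulas: conjunctions of atomic formulas. -/
inductive Formula (α : Type) : Type
  | cmp (c : Cmp) (t₁ t₂ : Term α .int) : Formula α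
  | seqEq (s₁ s₂ : Term α .seq) : Formula α
  | strEq (t₁ t₂ : Term α .str) : Formula α
  /-- the regular constraint `t ∈ e` -/
  | strIn (t : Term α .str) (e : RegularExpression α) : Formula α
  | and (φ ψ : Formula α) : Formula α

/-! ### Semantics -/

variable {α : Type}

/-- `seqNth s i u`: position `i` of `s` exists and holds `u`. -/
def seqNth (s : List (List α)) (i : ℤ) (u : List α) : Prop :=
  0 ≤ i ∧ s[i.toNat]? = some u

/-- `s[i → u]`: replace the element at position `i` by `u`; this is `s` if there is no such
position. -/
def seqWrite (s : List (List α)) (i : ℤ) (u : List α) : List (List α) :=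
  if 0 ≤ i then s.set i.toNat u else s

open Classical in
/-- The subsequence of those elements of `s` that match `e`. -/
noncomputable def seqFilter (e : RegularExpression α) (s : List (List α)) : List (List α) :=
  s.filter fun u => decide (u ∈ e.matches')

/-- `seqSub s i j r`: `s[i, j]` is defined and equal to `r`, the subsequence of the at most `j`
elements of `s` from position `i` on. It is defined if `i` is a position of `s` and `0 ≤ j`. -/
def seqSub (s : List (List α)) (i j : ℤ) (r : List (List α)) : Prop :=
  0 ≤ i ∧ i < s.length ∧ 0 ≤ j ∧ r = (s.drop i.toNat).take j.toNat

/-- In the string `p ++ v ++ w`, the displayed occurrence of `v` is the leftmost and longest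
substring that belongs to `L`: it belongs to `L`, and every occurrence of a member of `L` starts
further to the right, or starts at the same place and is not longer. -/
def LeftmostLongest (L : Language α) (p v w : List α) : Prop :=
  v ∈ L ∧ ∀ p' v' w' : List α, p' ++ v' ++ w' = p ++ v ++ w → v' ∈ L →
    p.length < p'.length ∨ (p.length = p'.length ∧ v'.length ≤ v.length)

/-- `Decomp L u us vs`: for `us = (u₁, …, uₖ)` and `vs = (v₁, …, vₖ₋₁)` we have
`u = u₁ v₁ u₂ v₂ ⋯ uₖ₋₁ vₖ₋₁ uₖ`, each `vᵢ` is the leftmost and longest substring of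
`uᵢ vᵢ uᵢ₊₁ ⋯ vₖ₋₁ uₖ` that belongs to `L`, and no substring of `uₖ` belongs to `L`. -/
inductive Decomp (L : Language α) : List α → List (List α) → List (List α) → Prop
  | last (u : List α) (h : ∀ v, v <:+: u → v ∉ L) : Decomp L u [u] []
  | step (p v w : List α) (us vs : List (List α)) (h : LeftmostLongest L p v w)
      (hw : Decomp L w us vs) : Decomp L (p ++ v ++ w) (p :: us) (v :: vs)

/-- An assignment of values to the variables. -/
structure Env (α : Type) where
  int : ℕ → ℤ
  str : ℕ → List α
  seq : ℕ → List (List α)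

/-- `t.Eval ρ x`: under the assignment `ρ`, the term `t` is defined and has the value `x`. A term
with an undefined subterm is undefined. -/
def Term.Eval (ρ : Env α) : {τ : Ty} → Term α τ → τ.Val α → Prop
  | _, .intConst m, x => x = m
  | _, .intVar n, x => x = ρ.int n
  | _, .add t₁ t₂, x => ∃ a b, t₁.Eval ρ a ∧ t₂.Eval ρ b ∧ x = a + b
  | _, .sub t₁ t₂, x => ∃ a b, t₁.Eval ρ a ∧ t₂.Eval ρ b ∧ x = a - b
  | _, .strlen t, x => ∃ u, t.Eval ρ u ∧ x = (List.length u : ℤ)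
  | _, .seqlen t, x => ∃ s, t.Eval ρ s ∧ x = (List.length s : ℤ)
  | _, .strConst u, x => x = u
  | _, .strVar n, x => x = ρ.str n
  | _, .strCat t₁ t₂, x => ∃ u v, t₁.Eval ρ u ∧ t₂.Eval ρ v ∧ x = u ++ v
  | _, .nth s i, x => ∃ a n, s.Eval ρ a ∧ i.Eval ρ n ∧ seqNth a n x
  | _, .join u s, x => ∃ a, s.Eval ρ a ∧ x = List.intercalate u a
  | _, .single t, x => ∃ u, t.Eval ρ u ∧ x = [u]
  | _, .seqConst s, x => x = s
  | _, .seqVar n, x => x = ρ.seq n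
  | _, .seqCat s₁ s₂, x => ∃ a b, s₁.Eval ρ a ∧ s₂.Eval ρ b ∧ x = a ++ b
  | _, .write s i t, x => ∃ a n u, s.Eval ρ a ∧ i.Eval ρ n ∧ t.Eval ρ u ∧ x = seqWrite a n u
  | _, .filter e s, x => ∃ a, s.Eval ρ a ∧ x = seqFilter e a
  | _, .subseq s i j, x => ∃ a m n, s.Eval ρ a ∧ i.Eval ρ m ∧ j.Eval ρ n ∧ seqSub a m n x
  | _, .split e t, x => ∃ u vs, t.Eval ρ u ∧ Decomp e.matches' u x vs
  | _, .matchAll e t, x => ∃ u us, t.Eval ρ u ∧ Decomp e.matches' u us x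

/-- The relation between integers denoted by a comparison symbol. -/
def Cmp.Holds : Cmp → ℤ → ℤ → Prop
  | .eq, a, b => a = b
  | .ne, a, b => a ≠ b
  | .lt, a, b => a < b
  | .le, a, b => a ≤ b
  | .gt, a, b => a > b
  | .ge, a, b => a ≥ b

/-- `φ.Holds ρ`: the assignment `ρ` satisfies `φ`. An atomic formula holds only if the terms in
it are defined. -/
def Formula.Holds (ρ : Env α) : Formula α → Prop
  | .cmp c t₁ t₂ => ∃ a b, t₁.Eval ρ a ∧ t₂.Eval ρ b ∧ c.Holds a b
  | .seqEq s₁ s₂ => ∃ a, s₁.Eval ρ a ∧ s₂.Eval ρ a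
  | .strEq t₁ t₂ => ∃ u, t₁.Eval ρ u ∧ t₂.Eval ρ u
  | .strIn t e => ∃ u, t.Eval ρ u ∧ u ∈ e.matches'
  | .and φ ψ => φ.Holds ρ ∧ ψ.Holds ρ

/-- Some assignment satisfies `φ`. -/
def Formula.Satisfiable (φ : Formula α) : Prop := ∃ ρ : Env α, φ.Holds ρ

/-! ### Gödel numbering -/

section Code

variable [Encodable α]

/-- The Gödel number of a regular expression. -/
def regCode : RegularExpression α → ℕ
  | .zero => Nat.pair 0 0
  | .epsilon => Nat.pair 1 0
  | .char a => Nat.pair 2 (Encodable.encode a)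
  | .plus e f => Nat.pair 3 (Nat.pair (regCode e) (regCode f))
  | .comp e f => Nat.pair 4 (Nat.pair (regCode e) (regCode f))
  | .star e => Nat.pair 5 (regCode e)

/-- The Gödel number of a term. -/
def Term.code : {τ : Ty} → Term α τ → ℕ
  | _, .intConst m => Nat.pair 0 (Encodable.encode m)
  | _, .intVar n => Nat.pair 1 n
  | _, .add t₁ t₂ => Nat.pair 2 (Nat.pair t₁.code t₂.code)
  | _, .sub t₁ t₂ => Nat.pair 3 (Nat.pair t₁.code t₂.code)
  | _, .strlen t => Nat.pair 4 t.code
  | _, .seqlen t => Nat.pair 5 t.code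
  | _, .strConst u => Nat.pair 6 (Encodable.encode u)
  | _, .strVar n => Nat.pair 7 n
  | _, .strCat t₁ t₂ => Nat.pair 8 (Nat.pair t₁.code t₂.code)
  | _, .nth s i => Nat.pair 9 (Nat.pair s.code i.code)
  | _, .join u s => Nat.pair 10 (Nat.pair (Encodable.encode u) s.code)
  | _, .single t => Nat.pair 11 t.code
  | _, .seqConst s => Nat.pair 12 (Encodable.encode s)
  | _, .seqVar n => Nat.pair 13 n
  | _, .seqCat s₁ s₂ => Nat.pair 14 (Nat.pair s₁.code s₂.code)
  | _, .write s i t => Nat.pair 15 (Nat.pair s.code (Nat.pair i.code t.code))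
  | _, .filter e s => Nat.pair 16 (Nat.pair (regCode e) s.code)
  | _, .subseq s i j => Nat.pair 17 (Nat.pair s.code (Nat.pair i.code j.code))
  | _, .split e t => Nat.pair 18 (Nat.pair (regCode e) t.code)
  | _, .matchAll e t => Nat.pair 19 (Nat.pair (regCode e) t.code)

/-- The number of a comparison symbol. -/
def Cmp.code : Cmp → ℕ
  | .eq => 0
  | .ne => 1
  | .lt => 2
  | .le => 3
  | .gt => 4
  | .ge => 5

/-- The Gödel number of a formula. -/
def Formula.code : Formula α → ℕ
  | .cmp c t₁ t₂ => Nat.pair 0 (Nat.pair c.code (Nat.pair t₁.code t₂.code))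
  | .seqEq s₁ s₂ => Nat.pair 1 (Nat.pair s₁.code s₂.code)
  | .strEq t₁ t₂ => Nat.pair 2 (Nat.pair t₁.code t₂.code)
  | .strIn t e => Nat.pair 3 (Nat.pair t.code (regCode e))
  | .and φ ψ => Nat.pair 4 (Nat.pair φ.code ψ.code)

theorem regCode_injective : Function.Injective (regCode (α := α)) := by
  intro e
  induction e <;> intro f h <;> cases f <;> simp [regCode, Nat.pair_eq_pair] at h ⊢ <;> grind

theorem Term.code_injective {τ : Ty} : Function.Injective (Term.code (α := α) (τ := τ)) := by
  intro t
  have hr := regCode_injective (α := α)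
  induction t <;> intro t' h <;> cases t' <;>
    simp [Term.code, Nat.pair_eq_pair, hr.eq_iff] at h ⊢ <;> grind

theorem Cmp.code_injective : Function.Injective Cmp.code := by
  intro c d h
  cases c <;> cases d <;> simp [Cmp.code] at h ⊢

/-- Distinct formulas have distinct Gödel numbers. -/
theorem Formula.code_injective : Function.Injective (Formula.code (α := α)) := by
  intro φ
  induction φ <;> intro ψ h <;> cases ψ <;>
    simp [Formula.code, Nat.pair_eq_pair, Term.code_injective.eq_iff, Cmp.code_injective.eq_iff,
      regCode_injective.eq_iff] at h ⊢ <;> grind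

end Code

end SeqStr

/-!
Satisfiability of string-sequence formulas is undecidable because the formulas express arbitrary
Diophantine equations, and these express the halting problem.

*Diophantine equations as formulas.* Addition is a term. For multiplication, the word equation
`s · (u) = (u) · s` between sequences says that `s` consists of copies of the string `u`; with
`seqlen(s) = x` and `strlen(u) = y` the string obtained by joining `s` with the empty separator has
length `x * y`. Only lengths of strings matter, so one letter is enough
(`SeqStr.NatExpr.eval_toTerm_of_guard`, `SeqStr.NatExpr.eqFormula_satisfiable_iff`). The equation
depends on the instance of the halting problem through a single integer constant, which makes the
Gödel number of the formula a primitive recursive function of that instance.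

*The halting problem as a Diophantine equation.* This is the theorem of Davis, Putnam, Robinson and
Matiyasevich (`Dioph.exists_poly_dom_iff`). Mathlib has Matiyasevich's part: exponentiation is
Diophantine. Binomial coefficients are digits of powers `(u + 1) ^ n` in base `u`, and
`n !` is the integer part of `r ^ n / r.choose n` for large `r`, so both are Diophantine.

The main step is that Diophantine sets are closed under bounded universal quantifiers
(`Dioph.forall_lt`). Suppose that for each `k < n` the polynomial `p (k, t)` has a zero `t = t k`
with coordinates at most `y`. Put `c = (B !) ^ 2 - 1` with `B` large. Then `c.choose n` is the
product of the pairwise coprime numbers `(c + 1) / (k + 1) - 1` for `k < n`, `c` is congruent to `k`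
modulo the `k`-th of them, and all their prime factors exceed `B`. The Chinese remainder theorem
gives numbers `a i` congruent to `t k i` modulo the `k`-th factor, so that `c.choose n` divides
`p (c, a)` and each product `a i * (a i - 1) * ⋯ * (a i - y)`. Conversely, given such `a`, take a
prime factor of the `k`-th modulus: the remainders of the `a i` are at most `y`, and at them
the value of `p (k, ·)` is divisible by a prime larger than its absolute value, hence zero.

With bounded quantifiers and Gödel's `β` function, an induction over the partial recursive functions
shows that their graphs are Diophantine (`Dioph.diophGraph_of_partrec`).
-/

/-! ### Binomial coefficients and factorials through powers -/

namespace Nat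

/-- By the binomial theorem, `n.choose k` is the `k`-th digit of `(u + 1) ^ n` in base `u`. -/
theorem choose_eq_pow_div_mod {n u : ℕ} (hu : 2 ^ n < u) (k : ℕ) :
    n.choose k = (u + 1) ^ n / u ^ k % u := by
  have h1 : ∀ i, n.choose i < u := fun i => (Nat.choose_le_two_pow n i).trans_lt hu
  have hu0 : 0 < u := by lia
  have key : ∀ (f : ℕ → ℕ), (∀ i, f i < u) → ∀ k N, k < N →
      (∑ i ∈ Finset.range N, f i * u ^ i) / u ^ k % u = f k := by
    intro f hf k
    induction k generalizing f with
    | zero =>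
      intro N hN
      obtain ⟨N, rfl⟩ := Nat.exists_eq_succ_of_ne_zero hN.ne'
      rw [Finset.sum_range_succ']
      simp only [pow_zero, Nat.div_one, mul_one, pow_succ, ← mul_assoc]
      rw [← Finset.sum_mul, Nat.mul_add_mod_self_right, Nat.mod_eq_of_lt (hf 0)]
    | succ k ih =>
      intro N hN
      obtain ⟨N, rfl⟩ := Nat.exists_eq_succ_of_ne_zero (by lia : N ≠ 0)
      rw [Finset.sum_range_succ', pow_succ', ← Nat.div_div_eq_div_mul]
      simp only [pow_zero, mul_one, pow_succ, ← mul_assoc]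
      rw [← Finset.sum_mul, Nat.add_div_of_dvd_right (Dvd.intro_left _ rfl),
        Nat.mul_div_cancel _ hu0, Nat.div_eq_of_lt (hf 0), add_zero,
        ih (fun i => f (i + 1)) (fun i => hf _) N (by lia)]
  have hs : (u + 1) ^ n = ∑ i ∈ Finset.range (n + 1), n.choose i * u ^ i := by
    rw [add_pow]
    exact Finset.sum_congr rfl fun i _ => by simp [mul_comm]
  have hs' : (u + 1) ^ n = ∑ i ∈ Finset.range (n + k + 1), n.choose i * u ^ i := by
    rw [hs]
    refine Finset.sum_subset (by simp) fun i _ hi => ?_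
    rw [Nat.choose_eq_zero_of_lt (by simpa using hi), zero_mul]
  rw [hs', key _ h1 k _ (by lia)]

/-- For large `r` the quotient `r ^ n / r.choose n` is only slightly larger than `n !`, because
`r ^ n` is only slightly larger than `r (r - 1) ⋯ (r - n + 1)`. -/
theorem factorial_eq_pow_div_choose {n r : ℕ} (hr : n ^ 2 * (n ! + 1) < r) :
    n ! = r ^ n / r.choose n := by
  have hnr : n ≤ r := by nlinarith [Nat.factorial_pos n]
  have hd := Nat.descFactorial_eq_factorial_mul_choose r n
  refine (Nat.div_eq_of_lt_le ?_ ?_).symm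
  · rw [← hd]; exact Nat.descFactorial_le_pow r n
  · have hlow : r ^ n ≤ r.descFactorial n + n ^ 2 * r ^ (n - 1) := by
      have h1 : (r - n) ^ n ≤ r.descFactorial n :=
        (Nat.pow_le_pow_left (by lia) n).trans (Nat.pow_sub_le_descFactorial r n)
      have h2 : r ^ n ≤ (r - n) ^ n + n * n * r ^ (n - 1) := by
        obtain ⟨d, rfl⟩ := Nat.exists_eq_add_of_le hnr
        simp only [Nat.add_sub_cancel_left]
        have h3 : ∀ m, (n + d) ^ m ≤ d ^ m + m * n * (n + d) ^ (m - 1) := by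
          intro m
          induction m with
          | zero => simp
          | succ m ih =>
            rcases Nat.eq_zero_or_pos m with rfl | hm
            · simp; lia
            · obtain ⟨m, rfl⟩ := Nat.exists_eq_succ_of_ne_zero hm.ne'
              simp only [Nat.add_sub_cancel, Nat.succ_eq_add_one] at ih ⊢
              have h4 : d ^ (m + 1) ≤ (n + d) ^ (m + 1) := Nat.pow_le_pow_left (by lia) _
              calc (n + d) ^ (m + 1 + 1) = (n + d) ^ (m + 1) * (n + d) := pow_succ _ _
                _ ≤ (d ^ (m + 1) + (m + 1) * n * (n + d) ^ m) * (n + d) := by gcongr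
                _ = d ^ (m + 1 + 1) + (m + 1) * n * (n + d) ^ (m + 1) + n * d ^ (m + 1) := by ring
                _ ≤ d ^ (m + 1 + 1) + (m + 1) * n * (n + d) ^ (m + 1) + n * (n + d) ^ (m + 1) := by
                  gcongr
                _ = _ := by ring
        exact h3 n
      nlinarith
    -- The claim is `r ^ n < (n ! + 1) * r.choose n`; it is proved after multiplication by `n !`.
    rcases Nat.eq_zero_or_pos n with rfl | hn
    · simp
    obtain ⟨m, rfl⟩ := Nat.exists_eq_succ_of_ne_zero hn.ne'
    simp only [Nat.succ_eq_add_one, Nat.add_sub_cancel] at *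
    have hr0 : 0 < r := by lia
    have hp : 0 < r ^ m := Nat.pow_pos hr0
    have h5 : (m + 1) ! * r ^ (m + 1) < ((m + 1) ! + 1) * r.descFactorial (m + 1) := by
      have : (m + 1) ^ 2 * ((m + 1) ! + 1) * r ^ m < r ^ (m + 1) := by
        rw [_root_.pow_succ' r]; exact Nat.mul_lt_mul_of_pos_right hr hp
      nlinarith [Nat.factorial_pos (m + 1)]
    rw [hd] at h5
    have h6 : 0 < (m + 1) ! := Nat.factorial_pos _
    have : (m + 1) ! * r ^ (m + 1) < (m + 1) ! * (((m + 1) ! + 1) * r.choose (m + 1)) := by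
      calc _ < _ := h5
        _ = _ := by ring
    exact lt_of_mul_lt_mul_left this (Nat.zero_le _)

/-! ### Pairwise coprime moduli whose product is a binomial coefficient -/

/-- A prime dividing the falling factorial `a (a - 1) ⋯ (a - y)` exhibits a residue of `a` that
is at most `y`. -/
theorem Prime.exists_modEq_of_dvd_descFactorial {p a y : ℕ} (hp : p.Prime)
    (h : p ∣ a.descFactorial (y + 1)) : ∃ j ≤ y, a ≡ j [MOD p] := by
  rw [Nat.descFactorial_eq_prod_range, hp.prime.dvd_finsetProd_iff] at h
  obtain ⟨i, hi, hd⟩ := h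
  have hi' : i ≤ y := by simpa [Nat.lt_succ_iff] using hi
  rcases le_total a i with hai | hia
  · exact ⟨a, hai.trans hi', rfl⟩
  · exact ⟨i, hi', ((Nat.modEq_iff_dvd' hia).2 hd).symm⟩

theorem dvd_descFactorial_of_modEq {m a y z : ℕ} (hz : z ≤ y) (h : a ≡ z [MOD m]) :
    m ∣ a.descFactorial (y + 1) := by
  rw [Nat.descFactorial_eq_prod_range]
  refine dvd_trans ?_ (Finset.dvd_prod_of_mem _ (Finset.mem_range.2 (Nat.lt_succ_of_le hz)))
  rcases le_total a z with haz | hza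
  · simp [Nat.sub_eq_zero_of_le haz]
  · exact (Nat.modEq_iff_dvd' hza).1 h.symm

/-- The modulus attached to the index `j` by the bound `B`. For `j < n ≤ B` these numbers are
pairwise coprime, have no prime factor up to `B`, and multiply to `((B !) ^ 2 - 1).choose n`;
moreover `(B !) ^ 2 - 1` is congruent to `j` modulo the `j`-th of them. -/
def indexModulus (B j : ℕ) : ℕ := (B !) ^ 2 / (j + 1) - 1

section indexModulus

variable {B j n : ℕ}

theorem indexModulus_add_one (hj : j < B) :
    indexModulus B j + 1 = B ! * (B ! / (j + 1)) := by
  have hd : j + 1 ∣ B ! := Nat.dvd_factorial (by lia) hj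
  have h1 : (B !) ^ 2 / (j + 1) = B ! * (B ! / (j + 1)) := by
    rw [sq, Nat.mul_div_assoc _ hd]
  have h2 : 0 < B ! / (j + 1) := Nat.div_pos (Nat.le_of_dvd (Nat.factorial_pos _) hd) (by lia)
  have h3 : 0 < B ! * (B ! / (j + 1)) := Nat.mul_pos (Nat.factorial_pos _) h2
  rw [indexModulus, h1]
  lia

theorem mul_indexModulus (hj : j < B) :
    (j + 1) * indexModulus B j = (B !) ^ 2 - 1 - j := by
  have h := indexModulus_add_one hj
  have hd : j + 1 ∣ B ! := Nat.dvd_factorial (by lia) hj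
  have h1 : (j + 1) * (indexModulus B j + 1) = (B !) ^ 2 := by
    rw [h, mul_left_comm, Nat.mul_div_cancel' hd, sq]
  lia

theorem lt_of_prime_dvd_indexModulus {p : ℕ} (hj : j < B) (hp : p.Prime)
    (h : p ∣ indexModulus B j) : B < p := by
  by_contra! hpB
  have h1 : p ∣ indexModulus B j + 1 := by
    rw [indexModulus_add_one hj]
    exact Dvd.dvd.mul_right (Nat.dvd_factorial hp.pos hpB) _
  exact hp.one_lt.ne' (Nat.dvd_one.1 ((Nat.dvd_add_right h).1 h1))

theorem one_lt_indexModulus (hB : 3 ≤ B) (hj : j < B) : 1 < indexModulus B j := by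
  have h := indexModulus_add_one hj
  have h1 : B ≤ B ! := Nat.self_le_factorial B
  have hd : j + 1 ∣ B ! := Nat.dvd_factorial (by lia) hj
  have h2 : 0 < B ! / (j + 1) := Nat.div_pos (Nat.le_of_dvd (Nat.factorial_pos _) hd) (by lia)
  nlinarith

theorem modEq_indexModulus (hj : j < B) : (B !) ^ 2 - 1 ≡ j [MOD indexModulus B j] := by
  have h := mul_indexModulus hj
  have h1 : j ≤ (B !) ^ 2 - 1 := by
    have : B ≤ B ! := Nat.self_le_factorial B
    have : B ! ≤ (B !) ^ 2 := Nat.le_self_pow (by lia) _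
    lia
  exact ((Nat.modEq_iff_dvd' h1).2 (h ▸ Dvd.intro_left _ rfl)).symm

theorem coprime_indexModulus {i : ℕ} (hi : i < B) (hj : j < B) (hij : i ≠ j) :
    Nat.Coprime (indexModulus B i) (indexModulus B j) := by
  refine Nat.coprime_of_dvd fun p hp h1 h2 => hij ?_
  have hB := lt_of_prime_dvd_indexModulus hi hp h1
  have h : i ≡ j [MOD p] :=
    ((modEq_indexModulus hi).of_dvd h1).symm.trans ((modEq_indexModulus hj).of_dvd h2)
  exact h.eq_of_lt_of_lt (hi.trans hB) (hj.trans hB)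

theorem prod_indexModulus (hn : n ≤ B) :
    ∏ j ∈ Finset.range n, indexModulus B j = ((B !) ^ 2 - 1).choose n := by
  have h := Nat.descFactorial_eq_factorial_mul_choose ((B !) ^ 2 - 1) n
  rw [Nat.descFactorial_eq_prod_range, ← Finset.prod_range_add_one_eq_factorial n] at h
  have h2 : ∏ i ∈ Finset.range n, ((B !) ^ 2 - 1 - i) =
      (∏ i ∈ Finset.range n, (i + 1)) * ∏ i ∈ Finset.range n, indexModulus B i := by
    rw [← Finset.prod_mul_distrib]
    exact Finset.prod_congr rfl fun i hi =>
      (mul_indexModulus ((Finset.mem_range.1 hi).trans_le hn)).symm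
  rw [h2] at h
  exact Nat.eq_of_mul_eq_mul_left (Finset.prod_pos fun i _ => by lia) h

/-- The product of the moduli divides a number if and only if each modulus does. -/
theorem choose_dvd_iff (hn : n ≤ B) {x : ℕ} :
    ((B !) ^ 2 - 1).choose n ∣ x ↔ ∀ j < n, indexModulus B j ∣ x := by
  rw [← prod_indexModulus hn]
  constructor
  · exact fun h j hj => (Finset.dvd_prod_of_mem _ (Finset.mem_range.2 hj)).trans h
  · intro h
    refine Finset.prod_dvd_of_isRelPrime (fun i hi j hj hij => ?_)
      fun j hj => h j (Finset.mem_range.1 hj)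
    have hi : i < n := by simpa using hi
    have hj : j < n := by simpa using hj
    exact Nat.coprime_iff_isRelPrime.1
      (coprime_indexModulus (hi.trans_le hn) (hj.trans_le hn) hij)

theorem exists_modEq_indexModulus (hB : 3 ≤ B) (hn : n ≤ B) (z : ℕ → ℕ) :
    ∃ a, ∀ j < n, a ≡ z j [MOD indexModulus B j] := by
  obtain ⟨a, ha⟩ := Nat.chineseRemainderOfFinset z (indexModulus B) (Finset.range n)
    (fun j hj => by
      have := one_lt_indexModulus hB ((Finset.mem_range.1 hj).trans_le hn)
      lia)
    (fun i hi j hj hij => by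
      have hi : i < n := by simpa using hi
      have hj : j < n := by simpa using hj
      exact coprime_indexModulus (hi.trans_le hn) (hj.trans_le hn) hij)
  exact ⟨a, fun j hj => ha j (Finset.mem_range.2 hj)⟩

end indexModulus

end Nat

/-! ### Integer polynomials -/

namespace Poly

variable {γ : Type}

theorem intModEq (p : Poly γ) {m : ℤ} {x y : γ → ℕ} (h : ∀ i, (x i : ℤ) ≡ y i [ZMOD m]) :
    p x ≡ p y [ZMOD m] := by
  induction p using Poly.induction with
  | H1 i => exact h i
  | H2 n => rfl
  | H3 f g hf hg => exact hf.sub hg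
  | H4 f g hf hg => exact hf.mul hg

theorem exists_monotone_bound (p : Poly γ) :
    ∃ q : (γ → ℕ) → ℕ, Dioph.DiophFn q ∧ Monotone q ∧ ∀ x, (p x).natAbs ≤ q x := by
  induction p using Poly.induction with
  | H1 i => exact ⟨fun x => x i, Dioph.proj_dioph i, fun _ _ h => h i, fun x => by simp⟩
  | H2 n =>
    exact ⟨fun _ => n.natAbs, Dioph.const_dioph _, fun _ _ _ => le_rfl, fun x => by simp⟩
  | H3 f g hf hg =>
    obtain ⟨a, da, ma, ha⟩ := hf
    obtain ⟨b, db, mb, hb⟩ := hg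
    exact ⟨fun x => a x + b x, Dioph.add_dioph da db, fun x y h => add_le_add (ma h) (mb h),
      fun x => (Int.natAbs_sub_le _ _).trans (add_le_add (ha x) (hb x))⟩
  | H4 f g hf hg =>
    obtain ⟨a, da, ma, ha⟩ := hf
    obtain ⟨b, db, mb, hb⟩ := hg
    exact ⟨fun x => a x * b x, Dioph.mul_dioph da db, fun x y h => Nat.mul_le_mul (ma h) (mb h),
      fun x => (Int.natAbs_mul _ _).trans_le (Nat.mul_le_mul (ha x) (hb x))⟩

theorem exists_finset_support (p : Poly γ) :
    ∃ s : Finset γ, ∀ x y : γ → ℕ, (∀ i ∈ s, x i = y i) → p x = p y := by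
  classical
  induction p using Poly.induction with
  | H1 i => exact ⟨{i}, fun x y h => by simp [h]⟩
  | H2 n => exact ⟨∅, fun x y h => rfl⟩
  | H3 f g hf hg =>
    obtain ⟨s, hs⟩ := hf
    obtain ⟨t, ht⟩ := hg
    refine ⟨s ∪ t, fun x y h => ?_⟩
    rw [Poly.sub_apply, Poly.sub_apply, hs x y fun i hi => h i (by simp [hi]),
      ht x y fun i hi => h i (by simp [hi])]
  | H4 f g hf hg =>
    obtain ⟨s, hs⟩ := hf
    obtain ⟨t, ht⟩ := hg
    refine ⟨s ∪ t, fun x y h => ?_⟩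
    rw [Poly.mul_apply, Poly.mul_apply, hs x y fun i hi => h i (by simp [hi]),
      ht x y fun i hi => h i (by simp [hi])]

end Poly

/-! ### Closure properties of Diophantine sets -/

namespace Dioph

variable {α : Type}

/-- The auxiliary variables of a Diophantine definition can be taken from a finite type. -/
theorem exists_poly_fin {S : Set (α → ℕ)} (h : Dioph S) :
    ∃ (m : ℕ) (p : Poly (α ⊕ Fin m)), ∀ v, v ∈ S ↔ ∃ t, p (Sum.elim v t) = 0 := by
  classical
  obtain ⟨β, p, hp⟩ := h
  obtain ⟨s, hs⟩ := p.exists_finset_support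
  let r : Finset β := s.toRight
  let e : β → Fin (r.card + 1) := fun b => if hb : b ∈ r then (r.equivFin ⟨b, hb⟩).castSucc else
    Fin.last _
  have he : Set.InjOn e r := by
    intro b hb c hc hbc
    have hb : b ∈ r := hb
    have hc : c ∈ r := hc
    simpa [e, hb, hc] using hbc
  refine ⟨r.card + 1, p.map (Sum.map id e), fun v => (hp v).trans ⟨?_, ?_⟩⟩
  · rintro ⟨t, ht⟩
    -- Only the variables in `r` matter, and `e` is injective on them.
    refine ⟨fun i => if h : ∃ b ∈ r, e b = i then t h.choose else 0, ?_⟩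
    rw [Poly.map_apply, ← ht]
    refine hs _ _ fun i hi => ?_
    rcases i with i | b
    · rfl
    · have hb : b ∈ r := by simpa [r] using hi
      have hex : ∃ c ∈ r, e c = e b := ⟨b, hb, rfl⟩
      have : hex.choose = b := he hex.choose_spec.1 hb hex.choose_spec.2
      simp only [Function.comp_apply, Sum.map_inr, Sum.elim_inr]
      rw [dif_pos hex, this]
  · rintro ⟨t, ht⟩
    refine ⟨t ∘ e, ?_⟩
    rw [← ht, Poly.map_apply]
    congr 1
    funext i
    rcases i with i | b <;> rfl

theorem true_dioph : Dioph {_v : α → ℕ | True} :=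
  of_no_dummies _ 0 fun v => by simp

theorem forall_fin {m : ℕ} {R : Fin m → (α → ℕ) → Prop} (h : ∀ i, Dioph {v | R i v}) :
    Dioph {v | ∀ i, R i v} := by
  induction m with
  | zero => exact true_dioph.ext fun v => by simp
  | succ m ih =>
    refine ((h 0).inter (ih fun i => h i.succ)).ext fun v => ?_
    exact (Fin.forall_fin_succ (P := fun i => R i v)).symm

/-- `Dioph.ex1_dioph` for a relation between an assignment and a number. -/
theorem exists_nat {R : (α → ℕ) → ℕ → Prop}
    (h : Dioph {w : Option α → ℕ | R (w ∘ some) (w none)}) : Dioph {v | ∃ x, R v x} :=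
  ex1_dioph h

section Functions

variable {f g : (α → ℕ) → ℕ}

theorem choose_dioph (df : DiophFn f) (dg : DiophFn g) :
    DiophFn fun v => (f v).choose (g v) := by
  have du : DiophFn fun v => 2 ^ f v + 1 := add_dioph (pow_dioph (const_dioph 2) df) (const_dioph 1)
  have h := mod_dioph (div_dioph (pow_dioph (add_dioph du (const_dioph 1)) df)
    (pow_dioph du dg)) du
  convert! h using 2 with v
  exact Nat.choose_eq_pow_div_mod (Nat.lt_succ_self _) _

open scoped Nat in
theorem factorial_dioph (df : DiophFn f) : DiophFn fun v => (f v)! := by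
  have d1 : DiophFn fun v => f v + 1 := add_dioph df (const_dioph 1)
  have dr : DiophFn fun v => 2 * (f v + 1) ^ (f v + 2) + 1 :=
    add_dioph (mul_dioph (const_dioph 2) (pow_dioph d1 (add_dioph df (const_dioph 2))))
      (const_dioph 1)
  have h := div_dioph (pow_dioph dr df) (choose_dioph dr df)
  convert! h using 2 with v
  refine Nat.factorial_eq_pow_div_choose (Nat.lt_succ_of_le ?_)
  have h1 : (f v)! ≤ (f v + 1) ^ f v :=
    (Nat.factorial_le_pow (f v)).trans (Nat.pow_le_pow_left (by lia) _)
  have h2 : 1 ≤ (f v + 1) ^ f v := Nat.one_le_pow _ _ (by lia)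
  calc (f v) ^ 2 * ((f v)! + 1) ≤ (f v + 1) ^ 2 * (2 * (f v + 1) ^ f v) := by
        gcongr <;> lia
    _ = 2 * (f v + 1) ^ (f v + 2) := by ring

theorem descFactorial_dioph (df : DiophFn f) (dg : DiophFn g) :
    DiophFn fun v => (f v).descFactorial (g v) := by
  simp only [Nat.descFactorial_eq_factorial_mul_choose]
  exact mul_dioph (factorial_dioph dg) (choose_dioph df dg)

end Functions

open scoped Nat in
/-- Elimination of a bounded universal quantifier: the witnesses `t` for all indices `k < n` are
merged, coordinate by coordinate, into a single witness `a` of congruences. -/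
theorem forall_lt_exists_eq_zero_iff {m : ℕ} (p : Poly (Option α ⊕ Fin m))
    {q : (Option α ⊕ Fin m → ℕ) → ℕ} (hq : Monotone q) (hpq : ∀ x, (p x).natAbs ≤ q x)
    (v : α → ℕ) (n : ℕ) :
    (∀ k < n, ∃ t, p (Sum.elim (Option.elim' k v) t) = 0) ↔
      ∃ (a : Fin m → ℕ) (y B c : ℕ), 3 ≤ B ∧ n ≤ B ∧ y < B ∧
        q (Sum.elim (Option.elim' n v) fun _ => y) < B ∧ c = (B !) ^ 2 - 1 ∧
        c.choose n ∣ (p (Sum.elim (Option.elim' c v) a)).natAbs ∧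
        ∀ i, c.choose n ∣ (a i).descFactorial (y + 1) := by
  constructor
  · intro h
    choose! t ht using h
    obtain ⟨y, hy⟩ : ∃ y, ∀ k < n, ∀ i, t k i ≤ y := by
      refine ⟨∑ k ∈ Finset.range n, ∑ i, t k i, fun k hk i => ?_⟩
      exact (Finset.single_le_sum (f := fun i => t k i) (fun _ _ => Nat.zero_le _)
        (Finset.mem_univ i)).trans (Finset.single_le_sum (f := fun k => ∑ i, t k i)
          (fun _ _ => Nat.zero_le _) (Finset.mem_range.2 hk))
    set Q := q (Sum.elim (Option.elim' n v) fun _ => y)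
    obtain ⟨B, h3, hn, hyB, hQ⟩ : ∃ B, 3 ≤ B ∧ n ≤ B ∧ y < B ∧ Q < B :=
      ⟨3 + n + y + Q + 1, by lia, by lia, by lia, by lia⟩
    have hcrt := fun i => Nat.exists_modEq_indexModulus h3 hn fun k => t k i
    choose a ha using hcrt
    refine ⟨a, y, B, _, h3, hn, hyB, hQ, rfl, ?_, fun i => ?_⟩
    · rw [Nat.choose_dvd_iff hn]
      intro k hk
      rw [← Int.natCast_dvd, ← Int.modEq_zero_iff_dvd, ← ht k hk]
      refine p.intModEq fun i => ?_
      rw [Int.natCast_modEq_iff]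
      rcases i with (_ | i) | i
      · exact Nat.modEq_indexModulus (hk.trans_le hn)
      · rfl
      · exact ha i k hk
    · rw [Nat.choose_dvd_iff hn]
      exact fun k hk => Nat.dvd_descFactorial_of_modEq (hy k hk i) (ha i k hk)
  · rintro ⟨a, y, B, c, h3, hn, hyB, hQ, rfl, hp, ha⟩ k hk
    have hkB := hk.trans_le hn
    obtain ⟨r, hr, hrk⟩ := Nat.exists_prime_and_dvd (Nat.one_lt_indexModulus h3 hkB).ne'
    have hBr := Nat.lt_of_prime_dvd_indexModulus hkB hr hrk
    have hz := fun i => hr.exists_modEq_of_dvd_descFactorial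
      (hrk.trans ((Nat.choose_dvd_iff hn).1 (ha i) k hk))
    choose z hzy hz using hz
    refine ⟨z, ?_⟩
    -- The value at `z` is divisible by a prime larger than its absolute value.
    have h1 : p (Sum.elim (Option.elim' k v) z) ≡ 0 [ZMOD r] := by
      have h2 : p (Sum.elim (Option.elim' ((B !) ^ 2 - 1) v) a) ≡ 0 [ZMOD r] := by
        rw [Int.modEq_zero_iff_dvd, Int.natCast_dvd]
        exact hrk.trans ((Nat.choose_dvd_iff hn).1 hp k hk)
      refine (p.intModEq fun i => ?_).trans h2
      rw [Int.natCast_modEq_iff]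
      rcases i with (_ | i) | i
      · exact ((Nat.modEq_indexModulus hkB).of_dvd hrk).symm
      · rfl
      · exact (hz i).symm
    have h2 : (p (Sum.elim (Option.elim' k v) z)).natAbs < r := by
      refine ((hpq _).trans (hq ?_)).trans_lt (hQ.trans hBr)
      rintro ((_ | i) | i)
      · exact hk.le
      · exact le_rfl
      · exact hzy i
    rw [Int.modEq_zero_iff_dvd, Int.natCast_dvd] at h1
    exact Int.natAbs_eq_zero.1 (Nat.eq_zero_of_dvd_of_lt h1 h2)

/-- Diophantine sets are closed under bounded universal quantification. -/
theorem forall_lt {R : (α → ℕ) → ℕ → Prop} {f : (α → ℕ) → ℕ}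
    (h : Dioph {w : Option α → ℕ | R (w ∘ some) (w none)}) (df : DiophFn f) :
    Dioph {v | ∀ k < f v, R v k} := by
  obtain ⟨m, p, hp⟩ := exists_poly_fin h
  obtain ⟨q, dq, mq, hq⟩ := p.exists_monotone_bound
  have hR : ∀ v k, R v k ↔ ∃ t, p (Sum.elim (Option.elim' k v) t) = 0 :=
    fun v k => hp (Option.elim' k v)
  -- The auxiliary variables `n`, `y`, `B`, `c` are numbered `0`, `1`, `2`, `3`.
  let aux : Fin 4 → α ⊕ (Fin m ⊕ Fin 4) := fun i => Sum.inr (Sum.inr i)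
  have D : ∀ i, DiophFn fun w : α ⊕ (Fin m ⊕ Fin 4) → ℕ => w (aux i) := fun i => proj_dioph _
  have dQ : DiophFn fun w : α ⊕ (Fin m ⊕ Fin 4) → ℕ =>
      q (w ∘ Sum.elim (Option.elim' (aux 0) Sum.inl) fun _ => aux 1) := reindex_diophFn _ dq
  have dP := abs_poly_dioph (p.map (Sum.elim (Option.elim' (aux 3) Sum.inl)
    fun i => (Sum.inr (Sum.inl i) : α ⊕ (Fin m ⊕ Fin 4))))
  have dW := choose_dioph (D 3) (D 0)
  have hd := ex_dioph <|
    (eq_dioph (D 0) (reindex_diophFn Sum.inl df)).inter <|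
    (le_dioph (const_dioph 3) (D 2)).inter <| (le_dioph (D 0) (D 2)).inter <|
    (lt_dioph (D 1) (D 2)).inter <| (lt_dioph dQ (D 2)).inter <|
    (eq_dioph (D 3) (sub_dioph (pow_dioph (factorial_dioph (D 2)) (const_dioph 2))
      (const_dioph 1))).inter <|
    (dvd_dioph dW dP).inter <|
    forall_fin fun i : Fin m => dvd_dioph dW
      (descFactorial_dioph (proj_dioph (Sum.inr (Sum.inl i))) (add_dioph (D 1) (const_dioph 1)))
  refine hd.ext fun v => ?_
  have hQ : ∀ t : Fin m ⊕ Fin 4 → ℕ,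
      Sum.elim v t ∘ Sum.elim (Option.elim' (aux 0) Sum.inl) (fun _ : Fin m => aux 1) =
        Sum.elim (Option.elim' (t (Sum.inr 0)) v) fun _ => t (Sum.inr 1) := by
    intro t
    funext j
    rcases j with (_ | j) | j <;> rfl
  have hP : ∀ t : Fin m ⊕ Fin 4 → ℕ,
      Sum.elim v t ∘ Sum.elim (Option.elim' (aux 3) Sum.inl)
          (fun i : Fin m => (Sum.inr (Sum.inl i) : α ⊕ (Fin m ⊕ Fin 4))) =
        Sum.elim (Option.elim' (t (Sum.inr 3)) v) (t ∘ Sum.inl) := by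
    intro t
    funext j
    rcases j with (_ | j) | j <;> rfl
  have hv : v ∈ {v | ∀ k < f v, R v k} ↔
      ∀ k < f v, ∃ t, p (Sum.elim (Option.elim' k v) t) = 0 :=
    forall₂_congr fun k _ => hR v k
  rw [hv, forall_lt_exists_eq_zero_iff p mq hq]
  constructor
  · rintro ⟨t, h0, h3, hn, hy, hB, hc, hp, ha⟩
    replace h0 : t (Sum.inr 0) = f v := h0
    simp only [Set.mem_ofPred_eq, hQ] at hB
    simp only [Set.mem_ofPred_eq, Poly.map_apply, hP] at hp
    refine ⟨t ∘ Sum.inl, t (Sum.inr 1), t (Sum.inr 2), t (Sum.inr 3), h3, h0 ▸ hn, hy, h0 ▸ hB, hc,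
      h0 ▸ hp, h0 ▸ ha⟩
  · rintro ⟨a, y, B, c, h3, hn, hy, hB, hc, hp, ha⟩
    refine ⟨Sum.elim a ![f v, y, B, c], rfl, h3, hn, hy, ?_, hc, ?_, ha⟩
    · simp only [Set.mem_ofPred_eq, hQ]
      exact hB
    · simp only [Set.mem_ofPred_eq, Poly.map_apply, hP]
      exact hp

end Dioph

/-! ### Graphs of partial recursive functions -/

namespace Nat

theorem exists_beta_eq (s : ℕ → ℕ) (n : ℕ) : ∃ c, ∀ i ≤ n, beta c i = s i := by
  refine ⟨unbeta ((List.range (n + 1)).map s), fun i hi => ?_⟩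
  have h := beta_unbeta_coe ((List.range (n + 1)).map s) ⟨i, by simp; lia⟩
  simpa using h

/-- A value of a (partial) primitive recursion is the last entry of a sequence of intermediate
values, and this sequence is coded by a number `c` through Gödel's `β` function. -/
theorem mem_rec_bind_iff {f : Part ℕ} {g : ℕ → ℕ → Part ℕ} {n m : ℕ} :
    m ∈ (Nat.rec f (fun y IH => IH.bind (g y)) n : Part ℕ) ↔
      ∃ c, beta c 0 ∈ f ∧ (∀ k < n, beta c (k + 1) ∈ g k (beta c k)) ∧ beta c n = m := by
  have key : m ∈ (Nat.rec f (fun y IH => IH.bind (g y)) n : Part ℕ) ↔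
      ∃ s : ℕ → ℕ, s 0 ∈ f ∧ (∀ k < n, s (k + 1) ∈ g k (s k)) ∧ s n = m := by
    induction n generalizing m with
    | zero =>
      refine ⟨fun h => ⟨fun _ => m, h, by simp, rfl⟩, ?_⟩
      rintro ⟨s, h0, -, rfl⟩
      exact h0
    | succ n ih =>
      simp only [Part.mem_bind_iff, ih]
      constructor
      · rintro ⟨_, ⟨s, h0, hs, rfl⟩, hm⟩
        refine ⟨fun i => if i ≤ n then s i else m, by simpa using h0, fun k hk => ?_, by simp⟩
        rcases Nat.lt_succ_iff_lt_or_eq.1 hk with hk | rfl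
        · simpa [hk.le, Nat.succ_le_of_lt hk] using hs k hk
        · simpa using hm
      · rintro ⟨s, h0, hs, rfl⟩
        exact ⟨_, ⟨s, h0, fun k hk => hs k (by lia), rfl⟩, hs n (by lia)⟩
  rw [key]
  constructor
  · rintro ⟨s, h0, hs, rfl⟩
    obtain ⟨c, hc⟩ := exists_beta_eq s n
    refine ⟨c, by rwa [hc 0 (by lia)], fun k hk => ?_, hc n le_rfl⟩
    rw [hc _ hk, hc _ hk.le]
    exact hs k hk
  · rintro ⟨c, h⟩
    exact ⟨beta c, h⟩

end Nat

namespace Dioph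

variable {α : Type}

section Functions

variable {f g : (α → ℕ) → ℕ}

theorem pair_dioph (df : DiophFn f) (dg : DiophFn g) :
    DiophFn fun v => Nat.pair (f v) (g v) := by
  have df' := reindex_diophFn some df
  have dg' := reindex_diophFn some dg
  have dz : DiophFn fun w : Option α → ℕ => w none := proj_dioph none
  refine (((lt_dioph df' dg').inter (eq_dioph (add_dioph (mul_dioph dg' dg') df') dz)).union
    ((le_dioph dg' df').inter
      (eq_dioph (add_dioph (add_dioph (mul_dioph df' df') df') dg') dz))).ext fun w => ?_
  change _ ∧ _ ∨ _ ∧ _ ↔ Nat.pair (f (w ∘ some)) (g (w ∘ some)) = w none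
  simp only [Nat.pair, Set.mem_ofPred_eq]
  split_ifs with h
  · simp [h]
  · simp [h]
    lia

theorem unpair_fst_dioph (df : DiophFn f) : DiophFn fun v => (f v).unpair.1 := by
  have h := exists_nat (R := fun (w : Option α → ℕ) b => Nat.pair (w none) b = f (w ∘ some)) <|
    eq_dioph (pair_dioph (proj_dioph (some none)) (proj_dioph none))
      (reindex_diophFn (some ∘ some) df)
  refine h.ext fun w => ?_
  change (∃ b, Nat.pair (w none) b = f (w ∘ some)) ↔ (f (w ∘ some)).unpair.1 = w none
  constructor
  · rintro ⟨b, hb⟩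
    simp [← hb]
  · exact fun hw => ⟨(f (w ∘ some)).unpair.2, by rw [← hw, Nat.pair_unpair]⟩

theorem unpair_snd_dioph (df : DiophFn f) : DiophFn fun v => (f v).unpair.2 := by
  have h := exists_nat (R := fun (w : Option α → ℕ) a => Nat.pair a (w none) = f (w ∘ some)) <|
    eq_dioph (pair_dioph (proj_dioph none) (proj_dioph (some none)))
      (reindex_diophFn (some ∘ some) df)
  refine h.ext fun w => ?_
  change (∃ a, Nat.pair a (w none) = f (w ∘ some)) ↔ (f (w ∘ some)).unpair.2 = w none
  constructor
  · rintro ⟨b, hb⟩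
    simp [← hb]
  · exact fun hw => ⟨(f (w ∘ some)).unpair.1, by rw [← hw, Nat.pair_unpair]⟩

theorem beta_dioph (df : DiophFn f) (dg : DiophFn g) :
    DiophFn fun v => Nat.beta (f v) (g v) :=
  mod_dioph (unpair_fst_dioph df) (add_dioph (mul_dioph (add_dioph dg (const_dioph 1))
    (unpair_snd_dioph df)) (const_dioph 1))

end Functions

/-- The graph of a partial function `f` is Diophantine, stated for Diophantine functions in place
of the two coordinates. -/
def DiophGraph (f : ℕ →. ℕ) : Prop :=
  ∀ {α : Type} {g h : (α → ℕ) → ℕ}, DiophFn g → DiophFn h → Dioph {v | h v ∈ f (g v)}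

theorem DiophGraph.of_total {f : ℕ → ℕ}
    (h : ∀ {α : Type} {g : (α → ℕ) → ℕ}, DiophFn g → DiophFn fun v => f (g v)) :
    DiophGraph (f : ℕ →. ℕ) :=
  fun dg dh => (eq_dioph dh (h dg)).ext fun v => by simp

/-- Every partial recursive function has a Diophantine graph. -/
theorem diophGraph_of_partrec {f : ℕ →. ℕ} (hf : Nat.Partrec f) : DiophGraph f := by
  induction hf with
  | zero => exact DiophGraph.of_total (f := fun _ => 0) fun _ => const_dioph 0
  | succ => exact DiophGraph.of_total fun dg => add_dioph dg (const_dioph 1)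
  | left => exact DiophGraph.of_total fun dg => unpair_fst_dioph dg
  | right => exact DiophGraph.of_total fun dg => unpair_snd_dioph dg
  | @pair f₁ f₂ _ _ h₁ h₂ =>
    intro α g h dg dh
    refine ((h₁ dg (unpair_fst_dioph dh)).inter (h₂ dg (unpair_snd_dioph dh))).ext fun v => ?_
    simp only [Set.mem_inter_iff, Set.mem_ofPred_eq, Seq.seq, Part.map_eq_map,
      Part.mem_bind_iff, Part.mem_map_iff]
    constructor
    · rintro ⟨ha, hb⟩
      exact ⟨_, ⟨_, ha, rfl⟩, _, hb, Nat.pair_unpair _⟩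
    · rintro ⟨_, ⟨a, ha, rfl⟩, b, hb, hab⟩
      rw [← hab, Nat.unpair_pair]
      exact ⟨ha, hb⟩
  | @comp f₁ f₂ _ _ h₁ h₂ =>
    intro α g h dg dh
    have := exists_nat (R := fun v x => x ∈ f₂ (g v) ∧ h v ∈ f₁ x) <|
      (h₂ (reindex_diophFn some dg) (proj_dioph none)).inter
        (h₁ (proj_dioph none) (reindex_diophFn some dh))
    refine this.ext fun v => ?_
    exact Part.mem_bind_iff.symm
  | @prec f₁ f₂ _ _ h₁ h₂ =>
    intro α g h dg dh
    -- Inside the quantifiers `∃ c, ∀ k`, the variables are `c = some none` and `k = none`.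
    have dk : DiophFn fun w : Option (Option α) → ℕ => w none := proj_dioph none
    have dc' : DiophFn fun w : Option (Option α) → ℕ => w (some none) := proj_dioph _
    have dc : DiophFn fun w : Option α → ℕ => w none := proj_dioph none
    have dg' := reindex_diophFn some dg
    have dh' := reindex_diophFn some dh
    have dstep := forall_lt
      (R := fun (w : Option α → ℕ) k => Nat.beta (w none) (k + 1) ∈
        f₂ (Nat.pair (g (w ∘ some)).unpair.1 (Nat.pair k (Nat.beta (w none) k))))
      (h₂ (pair_dioph (unpair_fst_dioph (reindex_diophFn (some ∘ some) dg))
        (pair_dioph dk (beta_dioph dc' dk))) (beta_dioph dc' (add_dioph dk (const_dioph 1))))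
      (unpair_snd_dioph dg')
    have := exists_nat
      (R := fun v c => Nat.beta c 0 ∈ f₁ (g v).unpair.1 ∧
        (∀ k < (g v).unpair.2, Nat.beta c (k + 1) ∈
          f₂ (Nat.pair (g v).unpair.1 (Nat.pair k (Nat.beta c k)))) ∧
        Nat.beta c (g v).unpair.2 = h v) <|
      (h₁ (unpair_fst_dioph dg') (beta_dioph dc (const_dioph 0))).inter <|
        dstep.inter (eq_dioph (beta_dioph dc (unpair_snd_dioph dg')) dh')
    refine this.ext fun v => ?_
    exact (Nat.mem_rec_bind_iff (f := f₁ (g v).unpair.1)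
      (g := fun y i => f₂ (Nat.pair (g v).unpair.1 (Nat.pair y i)))).symm
  | @rfind f₁ _ h₁ =>
    intro α g h dg dh
    have dsmall := forall_lt
      (R := fun v k => ∃ r, r ∈ f₁ (Nat.pair (g v) k) ∧ r ≠ 0)
      (exists_nat (R := fun (w : Option α → ℕ) r =>
          r ∈ f₁ (Nat.pair (g (w ∘ some)) (w none)) ∧ r ≠ 0) <|
        (h₁ (pair_dioph (reindex_diophFn (some ∘ some) dg) (proj_dioph (some none)))
          (proj_dioph none)).inter (ne_dioph (proj_dioph none) (const_dioph 0))) dh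
    refine ((h₁ (pair_dioph dg dh) (const_dioph 0)).inter dsmall).ext fun v => ?_
    change 0 ∈ f₁ (Nat.pair (g v) (h v)) ∧
      (∀ k < h v, ∃ r, r ∈ f₁ (Nat.pair (g v) k) ∧ r ≠ 0) ↔ _
    refine Iff.trans ?_ Nat.mem_rfind.symm
    simp [Part.mem_map_iff]

/-- The **DPRM theorem**: the domain of a partial recursive function is the projection of the
zero set of an integer polynomial. -/
theorem exists_poly_dom_iff {f : ℕ →. ℕ} (hf : Nat.Partrec f) :
    ∃ p : Poly ℕ, ∀ n, (f n).Dom ↔ ∃ t : ℕ → ℕ, t 0 = n ∧ p t = 0 := by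
  have h : Dioph {v : Unit → ℕ | ∃ x, x ∈ f (v ())} :=
    exists_nat (R := fun (v : Unit → ℕ) x => x ∈ f (v ())) <|
      diophGraph_of_partrec hf (proj_dioph (some ())) (proj_dioph none)
  obtain ⟨m, p, hp⟩ := exists_poly_fin h
  refine ⟨p.map (Sum.elim (fun _ => 0) fun i : Fin m => (i : ℕ) + 1), fun n => ?_⟩
  rw [Part.dom_iff_mem]
  refine (hp fun _ => n).trans ⟨?_, ?_⟩
  · rintro ⟨t, ht⟩
    refine ⟨fun i => i.casesOn n fun i => if hi : i < m then t ⟨i, hi⟩ else 0, rfl, ?_⟩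
    rw [Poly.map_apply, ← ht]
    congr 1
    funext i
    rcases i with i | i
    · rfl
    · simp
  · rintro ⟨t, rfl, ht⟩
    refine ⟨fun i => t (i + 1), ?_⟩
    rw [← ht, Poly.map_apply]
    congr 1
    funext i
    rcases i with i | i <;> rfl

end Dioph

/-! ### Diophantine equations as formulas on string sequences -/

namespace SeqStr

theorem eq_replicate_of_append_singleton_comm {β : Type} {u : β} {s : List β}
    (h : s ++ [u] = [u] ++ s) : s = List.replicate s.length u := by
  induction s with
  | nil => rfl
  | cons b s ih =>
    obtain ⟨rfl, h⟩ : b = u ∧ s ++ [u] = b :: s := by simpa using h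
    rw [List.length_cons, List.replicate_succ, ← ih h]

theorem intercalate_nil_eq_flatten {β : Type} (s : List (List β)) :
    List.intercalate [] s = s.flatten := by
  induction s with
  | nil => rfl
  | cons a s ih =>
    rcases s with _ | ⟨b, s⟩
    · simp [List.intercalate]
    · simpa [List.intercalate] using ih

/-- Polynomial expressions over the natural numbers. -/
inductive NatExpr
  | var (i : ℕ)
  | const (n : ℕ)
  | add (p q : NatExpr)
  | mul (p q : NatExpr)
  deriving Encodable

namespace NatExpr

/-- The value of an expression under an assignment of numbers to its variables. -/
def eval (v : ℕ → ℕ) : NatExpr → ℕ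
  | var i => v i
  | const n => n
  | add p q => p.eval v + q.eval v
  | mul p q => p.eval v * q.eval v

variable (α : Type)

/-- The integer term for an expression. A product is read off as the total length of the strings
in a sequence variable, whose index is the code of the product, so that distinct products have
distinct auxiliary variables. -/
def toTerm : NatExpr → Term α .int
  | var i => .intVar i
  | const n => .intConst n
  | add p q => .add p.toTerm q.toTerm
  | mul p q => .strlen (.join [] (.seqVar (Encodable.encode (mul p q))))

/-- The formula making `toTerm` correct. It says that the variables are not negative, and, for
each product `p * q`, that the auxiliary sequence consists of `p` copies of a string of length `q`.
That all its elements equal `u` is expressed by the word equation `s · (u) = (u) · s`. -/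
def guard : NatExpr → Formula α
  | var i => .cmp .ge (.intVar i) (.intConst 0)
  | const _ => .cmp .eq (.intConst 0) (.intConst 0)
  | add p q => p.guard.and q.guard
  | mul p q =>
    let s : Term α .seq := .seqVar (Encodable.encode (mul p q))
    let u : Term α .str := .strVar (Encodable.encode (mul p q))
    (p.guard.and q.guard).and <|
      (Formula.and (.cmp .eq (.seqlen s) (p.toTerm α)) (.cmp .eq (.strlen u) (q.toTerm α))).and <|
        .seqEq (.seqCat s (.single u)) (.seqCat (.single u) s)

variable {α}

theorem eval_toTerm_of_guard {ρ : Env α} {p : NatExpr} (h : (p.guard α).Holds ρ) (x : ℤ) :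
    (p.toTerm α).Eval ρ x ↔ x = p.eval fun i => (ρ.int i).toNat := by
  induction p generalizing x with
  | var i =>
    have hi : 0 ≤ ρ.int i := by simpa [guard, Formula.Holds, Term.Eval, Cmp.Holds] using h
    simp [toTerm, eval, Term.Eval, hi]
  | const n => simp [toTerm, eval, Term.Eval]
  | add p q hp hq => simp [toTerm, eval, Term.Eval, hp h.1, hq h.2]
  | mul p q hp hq =>
    obtain ⟨⟨h1, h2⟩, ⟨h3, h4⟩, h5⟩ := h
    simp only [Formula.Holds, Term.Eval, hp h1, hq h2, Cmp.Holds, exists_and_left, exists_eq_left,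
      ↓existsAndEq, true_and, Nat.cast_inj] at h3 h4 h5
    have hs := eq_replicate_of_append_singleton_comm h5
    have hlen := congrArg (fun s => s.flatten.length) hs
    simp only [List.length_flatten, List.map_replicate, List.sum_replicate, smul_eq_mul, h3,
      h4] at hlen
    simp [toTerm, eval, Term.Eval, intercalate_nil_eq_flatten, List.length_flatten, hlen]

/-- The assignment that extends `v` to the auxiliary variables; `a` is an arbitrary letter. -/
def env (a : α) (v : ℕ → ℕ) : Env α where
  int i := v i
  str k := match (Encodable.decode k : Option NatExpr) with
    | some (mul _ q) => List.replicate (q.eval v) a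
    | _ => []
  seq k := match (Encodable.decode k : Option NatExpr) with
    | some (mul p q) => List.replicate (p.eval v) (List.replicate (q.eval v) a)
    | _ => []

@[simp]
theorem env_int (a : α) (v : ℕ → ℕ) (i : ℕ) : (env a v).int i = v i := rfl

@[simp]
theorem env_str_mul (a : α) (v : ℕ → ℕ) (p q : NatExpr) :
    (env a v).str (Encodable.encode (mul p q)) = List.replicate (q.eval v) a := by
  simp [env]

@[simp]
theorem env_seq_mul (a : α) (v : ℕ → ℕ) (p q : NatExpr) :
    (env a v).seq (Encodable.encode (mul p q)) =
      List.replicate (p.eval v) (List.replicate (q.eval v) a) := by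
  simp [env]

theorem guard_holds_env (a : α) (v : ℕ → ℕ) (p : NatExpr) : (p.guard α).Holds (env a v) := by
  induction p with
  | var i => simp [guard, Formula.Holds, Term.Eval, Cmp.Holds]
  | const n => simp [guard, Formula.Holds, Term.Eval, Cmp.Holds]
  | add p q hp hq => exact ⟨hp, hq⟩
  | mul p q hp hq =>
    refine ⟨⟨hp, hq⟩, ⟨?_, ?_⟩, ?_⟩
    · simp [Formula.Holds, Term.Eval, Cmp.Holds, eval_toTerm_of_guard hp]
    · simp [Formula.Holds, Term.Eval, Cmp.Holds, eval_toTerm_of_guard hq]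
    · simp [Formula.Holds, Term.Eval, ← List.replicate_succ, ← List.replicate_succ']

/-- The formula saying that the equation `p = q` holds and that variable `0` has the value `n`. -/
def eqFormula (α : Type) (p q : NatExpr) (n : ℕ) : Formula α :=
  (Formula.cmp .eq (.intVar 0) (.intConst n)).and <|
    ((p.guard α).and (q.guard α)).and (.cmp .eq (p.toTerm α) (q.toTerm α))

theorem eqFormula_satisfiable_iff [Nonempty α] (p q : NatExpr) (n : ℕ) :
    (eqFormula α p q n).Satisfiable ↔ ∃ v : ℕ → ℕ, v 0 = n ∧ p.eval v = q.eval v := by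
  constructor
  · rintro ⟨ρ, h0, ⟨hp, hq⟩, x, y, hx, hy, rfl⟩
    rw [eval_toTerm_of_guard hp] at hx
    rw [eval_toTerm_of_guard hq] at hy
    refine ⟨fun i => (ρ.int i).toNat, ?_, by exact_mod_cast hx.symm.trans hy⟩
    have h0 : ρ.int 0 = n := by simpa [Formula.Holds, Term.Eval, Cmp.Holds] using h0
    simp [h0]
  · rintro ⟨v, rfl, hv⟩
    have a : α := Classical.arbitrary α
    have hp := guard_holds_env a v p
    have hq := guard_holds_env a v q
    refine ⟨env a v, ?_, ⟨hp, hq⟩, _, _, (eval_toTerm_of_guard hp _).2 rfl,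
      (eval_toTerm_of_guard hq _).2 rfl, ?_⟩
    · simp [Formula.Holds, Term.Eval, Cmp.Holds]
    · simpa [Cmp.Holds] using hv

theorem primrec_code_eqFormula [Encodable α] (p q : NatExpr) :
    Primrec fun n => (eqFormula α p q n).code := by
  -- Everything in the formula except the integer constant `n` is independent of `n`.
  have henc : ∀ n : ℕ, Encodable.encode (n : ℤ) = 2 * n := fun n => rfl
  simp only [eqFormula, Formula.code, Term.code, henc]
  have hpair := Primrec₂.natPair
  exact hpair.comp (.const _) <| hpair.comp
    (hpair.comp (.const _) <| hpair.comp (.const _) <| hpair.comp (.const _) <|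
      hpair.comp (.const _) <| Primrec.nat_mul.comp (.const 2) .id) (.const _)

/-- Moving negative terms to the other side turns the equation `f = 0` into an equation between
expressions over the natural numbers. -/
theorem exists_eval_sub_eval (f : Poly ℕ) :
    ∃ p q : NatExpr, ∀ v, f v = (p.eval v : ℤ) - q.eval v := by
  induction f using Poly.induction with
  | H1 i => exact ⟨var i, const 0, fun v => by simp [eval]⟩
  | H2 n => exact ⟨const n.toNat, const (-n).toNat, fun v => by simp [eval]⟩
  | H3 f g hf hg =>
    obtain ⟨p, q, h⟩ := hf
    obtain ⟨p', q', h'⟩ := hg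
    exact ⟨p.add q', q.add p', fun v => by simp [eval, h, h']; ring⟩
  | H4 f g hf hg =>
    obtain ⟨p, q, h⟩ := hf
    obtain ⟨p', q', h'⟩ := hg
    exact ⟨(p.mul p').add (q.mul q'), (p.mul q').add (q.mul p'),
      fun v => by simp [eval, h, h']; ring⟩

end NatExpr

end SeqStr

/-! ### Undecidability -/

theorem proposition1 (α : Type) [Finite α] [Nonempty α] [Encodable α] :
    ¬ ∃ f : ℕ → Bool, Computable f ∧
        ∀ φ : SeqStr.Formula α, f φ.code = true ↔ φ.Satisfiable := by
  rintro ⟨f, hf, hsat⟩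
  have hpart : Partrec fun n : ℕ =>
      Nat.Partrec.Code.eval (Denumerable.ofNat Nat.Partrec.Code n) 0 :=
    Nat.Partrec.Code.eval_part.comp (Computable.ofNat _) (Computable.const 0)
  obtain ⟨P, hP⟩ := Dioph.exists_poly_dom_iff (Partrec.nat_iff.1 hpart)
  obtain ⟨p, q, hpq⟩ := SeqStr.NatExpr.exists_eval_sub_eval P
  refine ComputablePred.halting_problem 0 (ComputablePred.computable_iff.2
    ⟨fun c => f (SeqStr.NatExpr.eqFormula α p q (Encodable.encode c)).code,
      hf.comp ((SeqStr.NatExpr.primrec_code_eqFormula p q).to_comp.comp Computable.encode), ?_⟩)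
  funext c
  refine propext ?_
  have h := hP (Encodable.encode c)
  rw [Denumerable.ofNat_encode] at h
  rw [h, hsat, SeqStr.NatExpr.eqFormula_satisfiable_iff]
  simp [hpq, sub_eq_zero]
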